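/- Let $n\ge 1$, let $H$ be a complex $n\times n$ matrix which is a contraction (operator norm at most $1$), and let $q\in(1,2]$ and $\gamma>0$. Put $$\log_q x=\frac{x^{q-1}-1}{q-1}\quad (x\ge 0),\qquad \exp_q x=\bigl(1+(q-1)x\bigr)^{1/(q-1)}\quad \Bigl(x>-\frac1{q-1}\Bigr),$$ where $\log_q 0=-\frac1{q-1}$ is the continuous extension, and apply these functions and real powers to Hermitian $n\times n$ matrices by functional calculus. Write $P>Q$ if $P-Q$ is positive definite and $P\ge Q$ if it is positive semi-definite. The reduced Tsallis relative entropy is $$S_{H,q}(X\mid Y)=\operatorname{Tr}\bigl[X^{2-q}\log_q X-H^*X^{2-q}H\log_q Y-X+Y\bigr].$$ (i) If $Y>0$ and $A=A^*$ with $A+H\log_q(Y)H^*>-\frac1{q-1}I$, then $$\gamma\log_q\bigl[\gamma^{-1}\operatorname{Tr}\exp_q\bigl(A+H\log_q(Y)H^*\bigr)\bigr]+\gamma-\operatorname{Tr}Y=\max\bigl\{\operatorname{Tr}[X^{2-q}A]-S_{H,q}(X\mid Y)\bigr\},$$ where the maximum is taken (and attained) over all positive definite $X$ with $\operatorname{Tr}X=\gamma$.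 (ii) If $X\ge 0$ with $\operatorname{Tr}X=\gamma$, and $B=B^*$ with $\log_q X>HBH^*$ and $B>-\frac1{q-1}I$, then $$S_{H,q}(X\mid\exp_q B)=\max\bigl\{\operatorname{Tr}[X^{2-q}A]-\gamma\log_q\bigl[\gamma^{-1}\operatorname{Tr}\exp_q(A+HBH^*)\bigr]-\gamma+\operatorname{Tr}\exp_q B\bigr\},$$ where the maximum is taken (and attained) over all positive definite $A$. -/

import Mathlib

open Matrix
open scoped ComplexOrder

noncomputable section

namespace ReducedTsallis

/-- The deformed logarithm `log_q x = (x^(q-1) - 1)/(q-1)` (for `q ≠ 1`). It is the usual function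
for `x > 0`; for `q > 1` its value at `x = 0` is the continuous extension `-1/(q-1)`. -/
def qLog (q x : ℝ) : ℝ := (x ^ (q - 1) - 1) / (q - 1)

/-- The deformed exponential `exp_q x = (x(q-1)+1)^(1/(q-1))` (for `q ≠ 1`), the inverse function of
`qLog q`, meaningful where `x(q-1)+1 > 0`. -/
def qExp (q x : ℝ) : ℝ := (x * (q - 1) + 1) ^ (1 / (q - 1))

/-- `log_q A` for a Hermitian matrix `A`, by functional calculus. -/
def matLog {n : ℕ} (q : ℝ) (A : Matrix (Fin n) (Fin n) ℂ) : Matrix (Fin n) (Fin n) ℂ :=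
  cfc (fun x : ℝ => qLog q x) A

/-- `exp_q A` for a Hermitian matrix `A`, by functional calculus. -/
def matExp {n : ℕ} (q : ℝ) (A : Matrix (Fin n) (Fin n) ℂ) : Matrix (Fin n) (Fin n) ℂ :=
  cfc (fun x : ℝ => qExp q x) A

/-- The real power `A^p` of a positive semi-definite matrix `A`, by functional calculus. -/
def matPow {n : ℕ} (A : Matrix (Fin n) (Fin n) ℂ) (p : ℝ) : Matrix (Fin n) (Fin n) ℂ :=
  cfc (fun x : ℝ => x ^ p) A

/-- The trace as a real number. It is only applied where the trace is real: to Hermitian matrices,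
to products of two Hermitian matrices, and to sums of these. -/
def reTr {n : ℕ} (A : Matrix (Fin n) (Fin n) ℂ) : ℝ := A.trace.re

/-- `H` is a contraction: its operator norm on `ℂⁿ` with the Euclidean norm is at most one. -/
def IsContraction {n : ℕ} (H : Matrix (Fin n) (Fin n) ℂ) : Prop :=
  ‖Matrix.toEuclideanCLM (n := Fin n) (𝕜 := ℂ) H‖ ≤ 1

/-- The reduced Tsallis relative entropy
`S_{H,q}(A|B) = Tr[A^(2-q) log_q A - H* A^(2-q) H log_q B - A + B]`. -/
def tsallisEntropy {n : ℕ} (H : Matrix (Fin n) (Fin n) ℂ) (q : ℝ)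
    (A B : Matrix (Fin n) (Fin n) ℂ) : ℝ :=
  reTr (matPow A (2 - q) * matLog q A - Hᴴ * matPow A (2 - q) * H * matLog q B - A + B)

end ReducedTsallis

end

open ReducedTsallis

/-! Put `p = q - 1` and `K = p (A + H log_q(Y) H*) + 1`. Since `p log_q Z + 1 = Z^p`, the objective
is affine in `Tr[X^(1-p) K]` once `Tr X` is fixed. Both parts then reduce to Hölder's inequality
`reTr_matPow_mul_le`, namely `Tr[X^(1-p) K] ≤ (Tr X)^(1-p) (Tr K^(1/p))^p`, where `K^(1/p)` is the
deformed exponential. Equality holds when `X` is a multiple of `K^(1/p)`: this gives the maximizer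
`X` in (i), and `A` solving `K = X^p` in (ii). -/

namespace ReducedTsallis

variable {n : ℕ}

/-! ### Functional calculus and traces -/

section Spectral

open Unitary

/-- Traces of products of functions of two Hermitian matrices are nonnegative combinations of
products of values on the spectra. -/
theorem exists_reTr_cfc_mul_cfc {X K : Matrix (Fin n) (Fin n) ℂ} (hX : X.IsHermitian)
    (hK : K.IsHermitian) :
    ∃ w : Fin n → Fin n → ℝ, (∀ i j, 0 ≤ w i j) ∧ ∀ f g : ℝ → ℝ,
      reTr (cfc f X * cfc g K)
        = ∑ i, ∑ j, f (hX.eigenvalues i) * g (hK.eigenvalues j) * w i j := by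
  set U : Matrix (Fin n) (Fin n) ℂ := (hX.eigenvectorUnitary).1
  set V : Matrix (Fin n) (Fin n) ℂ := (hK.eigenvectorUnitary).1
  -- The weights are the squared overlaps of the two eigenbases, hence independent of `f` and `g`.
  refine ⟨fun i j => Complex.normSq ((star U * V) i j), fun i j => Complex.normSq_nonneg _, ?_⟩
  intro f g
  rw [hX.cfc_eq, hK.cfc_eq, Matrix.IsHermitian.cfc, Matrix.IsHermitian.cfc, conjStarAlgAut_apply,
    conjStarAlgAut_apply]
  have h : ((U * diagonal (RCLike.ofReal ∘ f ∘ hX.eigenvalues) * star U) *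
      (V * diagonal (RCLike.ofReal ∘ g ∘ hK.eigenvalues) * star V)).trace =
      (diagonal (RCLike.ofReal ∘ f ∘ hX.eigenvalues) * (star U * V) *
        (diagonal (RCLike.ofReal ∘ g ∘ hK.eigenvalues) * star (star U * V))).trace := by
    rw [star_mul, star_star]
    simp only [Matrix.mul_assoc]
    rw [Matrix.trace_mul_comm]
    simp only [Matrix.mul_assoc]
  unfold reTr
  erw [h]
  simp only [Matrix.trace, Matrix.diag_apply, Matrix.mul_apply (M := diagonal _ * _),
    Matrix.diagonal_mul, Complex.re_sum]
  refine Finset.sum_congr rfl fun i _ => Finset.sum_congr rfl fun j _ => ?_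
  simp only [Function.comp_apply, Matrix.star_apply, RCLike.star_def, Complex.coe_algebraMap]
  rw [show (f (hX.eigenvalues i) : ℂ) * (star U * V) i j *
      ((g (hK.eigenvalues j) : ℂ) * (starRingEnd ℂ) ((star U * V) i j)) =
      ((f (hX.eigenvalues i) * g (hK.eigenvalues j) : ℝ) : ℂ) *
        ((star U * V) i j * (starRingEnd ℂ) ((star U * V) i j)) by push_cast; ring,
    Complex.mul_conj, ← Complex.ofReal_mul, Complex.ofReal_re]

/-- The spectrum is finite, so powers cause no trouble at `0`. -/
theorem continuousOn_spectrum (f : ℝ → ℝ) (X : Matrix (Fin n) (Fin n) ℂ) :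
    ContinuousOn f (spectrum ℝ X) :=
  X.finite_real_spectrum.continuousOn f

theorem cfc_const_one_eq {X : Matrix (Fin n) (Fin n) ℂ} (hX : X.IsHermitian) :
    cfc (fun _ : ℝ => (1 : ℝ)) X = 1 :=
  cfc_const_one ℝ X hX.isSelfAdjoint

theorem pos_of_mem_spectrum {X : Matrix (Fin n) (Fin n) ℂ} (hX : X.PosDef) {x : ℝ}
    (hx : x ∈ spectrum ℝ X) : 0 < x := by
  rw [hX.1.spectrum_real_eq_range_eigenvalues] at hx
  obtain ⟨i, rfl⟩ := hx
  exact hX.eigenvalues_pos i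

theorem nonneg_of_mem_spectrum {X : Matrix (Fin n) (Fin n) ℂ} (hX : X.PosSemidef) {x : ℝ}
    (hx : x ∈ spectrum ℝ X) : 0 ≤ x := by
  rw [hX.1.spectrum_real_eq_range_eigenvalues] at hx
  obtain ⟨i, rfl⟩ := hx
  exact hX.eigenvalues_nonneg i

open scoped MatrixOrder in
theorem posDef_cfc {f : ℝ → ℝ} {X : Matrix (Fin n) (Fin n) ℂ} (hX : X.IsHermitian)
    (hf : ∀ x ∈ spectrum ℝ X, 0 < f x) : (cfc f X).PosDef := by
  rw [← Matrix.isStrictlyPositive_iff_posDef,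
    cfc_isStrictlyPositive_iff f X (continuousOn_spectrum f X) hX.isSelfAdjoint]
  exact hf

theorem isHermitian_cfc (f : ℝ → ℝ) (X : Matrix (Fin n) (Fin n) ℂ) : (cfc f X).IsHermitian :=
  cfc_predicate f X

theorem isHermitian_matLog (q : ℝ) (X : Matrix (Fin n) (Fin n) ℂ) : (matLog q X).IsHermitian :=
  isHermitian_cfc _ X

theorem isHermitian_matExp (q : ℝ) (X : Matrix (Fin n) (Fin n) ℂ) : (matExp q X).IsHermitian :=
  isHermitian_cfc _ X

theorem reTr_add (A B : Matrix (Fin n) (Fin n) ℂ) : reTr (A + B) = reTr A + reTr B := by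
  simp [reTr]

theorem reTr_sub (A B : Matrix (Fin n) (Fin n) ℂ) : reTr (A - B) = reTr A - reTr B := by
  simp [reTr]

theorem reTr_smul (c : ℝ) (A : Matrix (Fin n) (Fin n) ℂ) : reTr (c • A) = c * reTr A := by
  simp [reTr]

theorem reTr_mul_comm (A B : Matrix (Fin n) (Fin n) ℂ) : reTr (A * B) = reTr (B * A) := by
  rw [reTr, Matrix.trace_mul_comm, reTr]

theorem reTr_posDef_pos (hn : 1 ≤ n) {K : Matrix (Fin n) (Fin n) ℂ} (hK : K.PosDef) :
    0 < reTr K := by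
  have : Nonempty (Fin n) := ⟨⟨0, hn⟩⟩
  exact (Complex.lt_def.mp hK.trace_pos).1

theorem trace_eq_ofReal_reTr {K : Matrix (Fin n) (Fin n) ℂ} (hK : K.IsHermitian) :
    K.trace = (reTr K : ℂ) := by
  have : star K.trace = K.trace := by rw [← Matrix.trace_conjTranspose, hK.eq]
  exact (Complex.conj_eq_iff_re.mp this).symm

end Spectral

/-- Hölder's inequality for traces, with exponents `1 / (1 - p)` and `1 / p`. -/
theorem reTr_matPow_mul_le {X K : Matrix (Fin n) (Fin n) ℂ} (hX : X.PosSemidef)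
    (hK : K.PosSemidef) {p : ℝ} (hp0 : 0 < p) (hp1 : p ≤ 1) (hXt : 0 < reTr X)
    (hKt : 0 < reTr (matPow K (1 / p))) :
    reTr (matPow X (1 - p) * K) ≤ reTr X ^ (1 - p) * reTr (matPow K (1 / p)) ^ p := by
  obtain ⟨w, hw, h⟩ := exists_reTr_cfc_mul_cfc hX.1 hK.1
  -- The same weights express all three traces, so a scalar inequality suffices.
  have h1 := h (fun x => x ^ (1 - p)) (fun x => x)
  have h2 := h (fun x => x) (fun _ => 1)
  have h3 := h (fun _ => 1) (fun x => x ^ (1 / p))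
  simp only [cfc_id' ℝ K hK.1.isSelfAdjoint] at h1
  simp only [cfc_id' ℝ X hX.1.isSelfAdjoint, cfc_const_one_eq hK.1, mul_one] at h2
  simp only [cfc_const_one_eq hX.1, one_mul] at h3
  change reTr (matPow X (1 - p) * K) = _ at h1
  change reTr (matPow K (1 / p)) = _ at h3
  set s := reTr X
  set t := reTr (matPow K (1 / p))
  -- Weighted AM-GM for `x / s` and `k^(1/p) / t`; after this normalization the summed right side
  -- has total weight `(1 - p) + p = 1`.
  have key : ∀ x k : ℝ, 0 ≤ x → 0 ≤ k →
      x ^ (1 - p) * k ≤ s ^ (1 - p) * t ^ p * ((1 - p) / s * x + p / t * k ^ (1 / p)) := by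
    intro x k hx hk
    have hk' : (k ^ (1 / p)) ^ p = k := by
      rw [← Real.rpow_mul hk, one_div_mul_cancel hp0.ne', Real.rpow_one]
    have hkk : 0 ≤ k ^ (1 / p) := Real.rpow_nonneg hk _
    have := Real.geom_mean_le_arith_mean2_weighted (sub_nonneg.mpr hp1) hp0.le
      (div_nonneg hx hXt.le) (div_nonneg hkk hKt.le) (by ring)
    rw [Real.div_rpow hx hXt.le, Real.div_rpow hkk hKt.le, hk'] at this
    have hsp : 0 < s ^ (1 - p) := Real.rpow_pos_of_pos hXt _
    have htp : 0 < t ^ p := Real.rpow_pos_of_pos hKt _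
    calc x ^ (1 - p) * k
        = s ^ (1 - p) * t ^ p * (x ^ (1 - p) / s ^ (1 - p) * (k / t ^ p)) := by field_simp
      _ ≤ s ^ (1 - p) * t ^ p * ((1 - p) * (x / s) + p * (k ^ (1 / p) / t)) := by gcongr
      _ = _ := by ring
  calc reTr (matPow X (1 - p) * K)
      ≤ ∑ i, ∑ j, s ^ (1 - p) * t ^ p * ((1 - p) / s * hX.1.eigenvalues i
          + p / t * hK.1.eigenvalues j ^ (1 / p)) * w i j := by
        rw [h1]
        refine Finset.sum_le_sum fun i _ => Finset.sum_le_sum fun j _ => ?_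
        exact mul_le_mul_of_nonneg_right
          (key _ _ (hX.eigenvalues_nonneg i) (hK.eigenvalues_nonneg j)) (hw i j)
    _ = s ^ (1 - p) * t ^ p * ((1 - p) / s * s + p / t * t) := by
        generalize s ^ (1 - p) * t ^ p = c, (1 - p) / s = a, p / t = b
        conv_rhs => rw [h2, h3]
        simp only [Finset.mul_sum, ← Finset.sum_add_distrib]
        refine Finset.sum_congr rfl fun i _ => Finset.sum_congr rfl fun j _ => ?_
        ring
    _ = s ^ (1 - p) * t ^ p := by
        rw [div_mul_cancel₀ _ hXt.ne', div_mul_cancel₀ _ hKt.ne']; ring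

/-! ### Powers, deformed logarithms and exponentials -/

theorem matPow_mul_matPow {X : Matrix (Fin n) (Fin n) ℂ} (hX : X.PosSemidef) {p : ℝ}
    (hp0 : 0 < p) (hp1 : p ≤ 1) : matPow X (1 - p) * matPow X p = X := by
  unfold matPow
  rw [← cfc_mul _ _ X (continuousOn_spectrum _ X) (continuousOn_spectrum _ X)]
  conv_rhs => rw [← cfc_id' ℝ X hX.1.isSelfAdjoint]
  refine cfc_congr fun x hx => ?_
  have := nonneg_of_mem_spectrum hX hx
  -- At `x = 0` and `p = 1` this relies on `0 ^ 0 = 1`.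
  rw [← Real.rpow_add_of_nonneg this (sub_nonneg.mpr hp1) hp0.le, sub_add_cancel, Real.rpow_one]

theorem matPow_matPow {X : Matrix (Fin n) (Fin n) ℂ} (hX : X.PosSemidef) (a b : ℝ) :
    matPow (matPow X a) b = matPow X (a * b) := by
  unfold matPow
  rw [← cfc_comp' _ _ X ((X.finite_real_spectrum.image _).continuousOn _)
    (continuousOn_spectrum _ X) hX.1.isSelfAdjoint]
  exact cfc_congr fun x hx => (Real.rpow_mul (nonneg_of_mem_spectrum hX hx) _ _).symm

theorem matPow_one {X : Matrix (Fin n) (Fin n) ℂ} (hX : X.IsHermitian) : matPow X 1 = X := by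
  simpa only [matPow, Real.rpow_one] using cfc_id' ℝ X hX.isSelfAdjoint

theorem posDef_matPow {X : Matrix (Fin n) (Fin n) ℂ} (hX : X.PosDef) (a : ℝ) :
    (matPow X a).PosDef :=
  posDef_cfc hX.1 fun _ hx => Real.rpow_pos_of_pos (pos_of_mem_spectrum hX hx) a

theorem matPow_smul {X : Matrix (Fin n) (Fin n) ℂ} (hX : X.PosSemidef) {c : ℝ} (hc : 0 ≤ c)
    (a : ℝ) : matPow (c • X) a = c ^ a • matPow X a := by
  unfold matPow
  rw [← cfc_smul _ _ X (continuousOn_spectrum _ X)]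
  conv_lhs => rw [← cfc_id' ℝ X hX.1.isSelfAdjoint, ← cfc_smul _ _ X (continuousOn_spectrum _ X)]
  rw [← cfc_comp' _ _ X ((X.finite_real_spectrum.image _).continuousOn _)
    (continuousOn_spectrum _ X) hX.1.isSelfAdjoint]
  refine cfc_congr fun x hx => ?_
  simp only [smul_eq_mul]
  exact Real.mul_rpow hc (nonneg_of_mem_spectrum hX hx)

theorem matExp_eq {q : ℝ} {C : Matrix (Fin n) (Fin n) ℂ} (hC : C.IsHermitian) :
    matExp q C = matPow ((q - 1) • C + 1) (1 / (q - 1)) := by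
  have h : (q - 1) • C + 1 = cfc (fun x : ℝ => x * (q - 1) + 1) C := by
    rw [cfc_add_const _ _ C (continuousOn_spectrum _ C) hC.isSelfAdjoint]
    simp only [mul_comm _ (q - 1)]
    rw [cfc_const_mul_id _ C hC.isSelfAdjoint]
    simp
  rw [h, matPow, ← cfc_comp' _ _ C ((C.finite_real_spectrum.image _).continuousOn _)
    (continuousOn_spectrum _ C) hC.isSelfAdjoint]
  rfl

theorem matPow_eq {q : ℝ} (hq : 1 < q) {X : Matrix (Fin n) (Fin n) ℂ} (hX : X.IsHermitian) :
    matPow X (q - 1) = (q - 1) • matLog q X + 1 := by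
  have hp : q - 1 ≠ 0 := (sub_pos.mpr hq).ne'
  unfold matPow matLog
  rw [← cfc_smul _ _ X (continuousOn_spectrum _ X), ← cfc_const_one_eq hX,
    ← cfc_add (a := X) _ _ (continuousOn_spectrum _ X) (continuousOn_spectrum _ X)]
  refine cfc_congr fun x _ => ?_
  simp only [qLog, smul_eq_mul]
  field_simp
  ring

theorem matLog_matExp {q : ℝ} (hq : 1 < q) {B : Matrix (Fin n) (Fin n) ℂ}
    (hB : B.IsHermitian) (hK : ((q - 1) • B + 1).PosSemidef) : matLog q (matExp q B) = B := by
  have hp : q - 1 ≠ 0 := (sub_pos.mpr hq).ne'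
  have h := matPow_eq hq (isHermitian_matExp q B)
  conv_lhs at h => rw [matExp_eq hB]
  rw [matPow_matPow hK, one_div_mul_cancel hp, matPow_one hK.1, add_left_inj] at h
  exact (smul_right_injective _ hp h).symm

theorem posDef_smul_add_one {q : ℝ} (hq : 1 < q) {C : Matrix (Fin n) (Fin n) ℂ}
    (h : (C - (-(1 / (q - 1))) • (1 : Matrix (Fin n) (Fin n) ℂ)).PosDef) :
    ((q - 1) • C + 1).PosDef := by
  have hp : 0 < q - 1 := sub_pos.mpr hq
  have := h.smul hp
  rwa [smul_sub, smul_smul, mul_neg, mul_one_div_cancel hp.ne', neg_smul, one_smul,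
    sub_neg_eq_add] at this

open scoped MatrixOrder Matrix.Norms.L2Operator in
theorem IsContraction.posSemidef {H : Matrix (Fin n) (Fin n) ℂ} (hH : IsContraction H) :
    (1 - H * Hᴴ).PosSemidef := by
  have h1 : ‖H‖ ≤ 1 := hH
  have h2 := CStarAlgebra.mul_star_le_algebraMap_norm_sq (a := H)
  rw [← Matrix.le_iff]
  refine h2.trans ?_
  rw [← map_one (algebraMap ℝ (Matrix (Fin n) (Fin n) ℂ))]
  exact algebraMap_mono _ (pow_le_one₀ (norm_nonneg _) h1)

/-- The contraction hypothesis absorbs the defect `1 - H H*` left when the identity is moved inside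
`H · H*`. -/
theorem IsContraction.posDef_smul_add_one {H : Matrix (Fin n) (Fin n) ℂ} (hH : IsContraction H)
    {p : ℝ} (hp : 0 < p) {A B : Matrix (Fin n) (Fin n) ℂ} (hA : A.PosDef)
    (hB : (p • B + 1).PosSemidef) : (p • (A + H * B * Hᴴ) + 1).PosDef := by
  have : p • (A + H * B * Hᴴ) + 1 = p • A + (H * (p • B + 1) * Hᴴ + (1 - H * Hᴴ)) := by
    simp only [Matrix.mul_add, Matrix.add_mul, Matrix.mul_smul, Matrix.smul_mul, Matrix.mul_one,
      smul_add]
    abel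
  rw [this]
  exact (hA.smul hp).add_posSemidef ((hB.mul_mul_conjTranspose_same H).add hH.posSemidef)

theorem matPow_mul_matLog {q : ℝ} (hq : q ∈ Set.Ioc (1 : ℝ) 2) {X : Matrix (Fin n) (Fin n) ℂ}
    (hX : X.PosSemidef) :
    (q - 1) • (matPow X (2 - q) * matLog q X) = X - matPow X (2 - q) := by
  have h := matPow_mul_matPow hX (sub_pos.mpr hq.1) (p := q - 1) (by linarith [hq.2])
  rw [matPow_eq hq.1 hX.1, show 1 - (q - 1) = 2 - q by ring, Matrix.mul_add, Matrix.mul_smul,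
    Matrix.mul_one] at h
  exact eq_sub_of_add_eq h

/-- The objective function in terms of the linear functional `X^(2-q) ↦ Tr X^(2-q) K`. -/
theorem reTr_matPow_mul_sub_tsallisEntropy {q : ℝ} (hq : q ∈ Set.Ioc (1 : ℝ) 2)
    (H A Y : Matrix (Fin n) (Fin n) ℂ) {X : Matrix (Fin n) (Fin n) ℂ} (hX : X.PosSemidef) :
    reTr (matPow X (2 - q) * A) - tsallisEntropy H q X Y =
      (reTr (matPow X (2 - q) * ((q - 1) • (A + H * matLog q Y * Hᴴ) + 1)) - reTr X) / (q - 1)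
        + reTr X - reTr Y := by
  have hp : q - 1 ≠ 0 := (sub_pos.mpr hq.1).ne'
  have h1 := congrArg reTr (matPow_mul_matLog hq hX)
  rw [reTr_smul, reTr_sub] at h1
  have h2 : reTr (Hᴴ * matPow X (2 - q) * H * matLog q Y)
      = reTr (matPow X (2 - q) * (H * matLog q Y * Hᴴ)) := by
    rw [Matrix.mul_assoc, Matrix.mul_assoc, reTr_mul_comm, Matrix.mul_assoc]
  simp only [tsallisEntropy, reTr_add, reTr_sub, Matrix.mul_add, Matrix.mul_smul, reTr_smul,
    Matrix.mul_one, h2]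
  field_simp
  linear_combination -h1

/-- The deformed logarithm of the trace of the deformed exponential, in terms of powers. -/
theorem mul_qLog_inv_mul {q γ t : ℝ} (hγ : 0 < γ) (ht : 0 ≤ t) :
    γ * qLog q (γ⁻¹ * t) = (γ ^ (1 - (q - 1)) * t ^ (q - 1) - γ) / (q - 1) := by
  rw [qLog, Real.mul_rpow (inv_nonneg.mpr hγ.le) ht, Real.inv_rpow hγ.le,
    Real.rpow_sub hγ 1, Real.rpow_one]
  field_simp

end ReducedTsallis

/-! ### The two variational formulas -/

theorem theorem2p8 (n : ℕ) (hn : 1 ≤ n) (H : Matrix (Fin n) (Fin n) ℂ)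
    (hH : ReducedTsallis.IsContraction H)
    (q : ℝ) (hq : q ∈ Set.Ioc (1 : ℝ) 2) (γ : ℝ) (hγ : 0 < γ) :
    (∀ A Y : Matrix (Fin n) (Fin n) ℂ, Y.PosDef → A.IsHermitian →
      (A + H * ReducedTsallis.matLog q Y * Hᴴ -
        (-(1 / (q - 1))) • (1 : Matrix (Fin n) (Fin n) ℂ)).PosDef →
      IsGreatest
        ((fun X : Matrix (Fin n) (Fin n) ℂ =>
            ReducedTsallis.reTr (ReducedTsallis.matPow X (2 - q) * A)
              - ReducedTsallis.tsallisEntropy H q X Y) ''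
          {X | X.PosDef ∧ X.trace = (γ : ℂ)})
        (γ * ReducedTsallis.qLog q (γ⁻¹ * ReducedTsallis.reTr
            (ReducedTsallis.matExp q (A + H * ReducedTsallis.matLog q Y * Hᴴ)))
          + γ - ReducedTsallis.reTr Y)) ∧
    (∀ X B : Matrix (Fin n) (Fin n) ℂ, X.PosSemidef → X.trace = (γ : ℂ) → B.IsHermitian →
      (ReducedTsallis.matLog q X - H * B * Hᴴ).PosDef →
      (B - (-(1 / (q - 1))) • (1 : Matrix (Fin n) (Fin n) ℂ)).PosDef →
      IsGreatest
        ((fun A : Matrix (Fin n) (Fin n) ℂ =>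
            ReducedTsallis.reTr (ReducedTsallis.matPow X (2 - q) * A)
              - γ * ReducedTsallis.qLog q (γ⁻¹ * ReducedTsallis.reTr
                  (ReducedTsallis.matExp q (A + H * B * Hᴴ)))
              - γ + ReducedTsallis.reTr (ReducedTsallis.matExp q B)) ''
          {A | A.PosDef})
        (ReducedTsallis.tsallisEntropy H q X (ReducedTsallis.matExp q B))) := by
  have hp : 0 < q - 1 := sub_pos.mpr hq.1
  have hp1 : q - 1 ≤ 1 := by linarith [hq.2]
  have hq2 : 1 - (q - 1) = 2 - q := by ring
  refine ⟨fun A Y hY hA hK => ?_, fun X B hX hXt hB hL hK => ?_⟩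
  · have hC : (A + H * matLog q Y * Hᴴ).IsHermitian :=
      hA.add (isHermitian_mul_mul_conjTranspose H (isHermitian_matLog q Y))
    replace hK := posDef_smul_add_one hq.1 hK
    rw [matExp_eq hC]
    set K := (q - 1) • (A + H * matLog q Y * Hᴴ) + 1 with hKdef
    have hE := posDef_matPow hK (1 / (q - 1))
    have ht := reTr_posDef_pos hn hE
    set t := reTr (matPow K (1 / (q - 1))) with htdef
    rw [mul_qLog_inv_mul hγ ht.le]
    constructor
    · have hc : 0 < γ / t := div_pos hγ ht
      have hXt : reTr ((γ / t) • matPow K (1 / (q - 1))) = γ := by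
        rw [reTr_smul, ← htdef, div_mul_cancel₀ _ ht.ne']
      have hXp : ((γ / t) • matPow K (1 / (q - 1))).PosDef := hE.smul hc
      refine ⟨(γ / t) • matPow K (1 / (q - 1)), ⟨hXp, ?_⟩, ?_⟩
      · rw [trace_eq_ofReal_reTr hXp.1, hXt]
      · have h1 := matPow_mul_matPow hE.posSemidef hp hp1
        rw [matPow_matPow hK.posSemidef _ (q - 1), one_div_mul_cancel hp.ne',
          matPow_one hK.1] at h1
        simp only
        rw [reTr_matPow_mul_sub_tsallisEntropy hq H A Y hXp.posSemidef, hXt, ← hKdef, ← hq2,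
          matPow_smul hE.posSemidef hc.le, Matrix.smul_mul, h1, reTr_smul, ← htdef,
          Real.div_rpow hγ.le ht.le, Real.rpow_sub ht, Real.rpow_one]
        have : t ^ (q - 1) ≠ 0 := (Real.rpow_pos_of_pos ht _).ne'
        field_simp
    · rintro _ ⟨X, ⟨hX, hXt⟩, rfl⟩
      have hXt' : reTr X = γ := by rw [reTr, hXt, Complex.ofReal_re]
      have h := reTr_matPow_mul_le hX.posSemidef hK.posSemidef hp hp1 (hXt' ▸ hγ) ht
      simp only
      rw [reTr_matPow_mul_sub_tsallisEntropy hq H A Y hX.posSemidef, hXt', ← hKdef, ← hq2]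
      rw [hXt'] at h
      gcongr
  · have hXt' : reTr X = γ := by rw [reTr, hXt, Complex.ofReal_re]
    replace hK := posDef_smul_add_one hq.1 hK
    have hS := fun A => reTr_matPow_mul_sub_tsallisEntropy hq H A (matExp q B) hX
    rw [matLog_matExp hq.1 hB hK.posSemidef, hXt'] at hS
    constructor
    · refine ⟨matLog q X - H * B * Hᴴ, hL, ?_⟩
      have h := hS (matLog q X - H * B * Hᴴ)
      rw [sub_add_cancel, ← matPow_eq hq.1 hX.1, ← hq2, matPow_mul_matPow hX hp hp1, hXt'] at h
      simp only
      rw [sub_add_cancel, matExp_eq (isHermitian_matLog q X), ← hq2]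
      rw [← matPow_eq hq.1 hX.1, matPow_matPow hX, mul_one_div_cancel hp.ne', matPow_one hX.1,
        hXt', inv_mul_cancel₀ hγ.ne', qLog, Real.one_rpow]
      simp only [sub_self, zero_div, mul_zero, sub_zero] at h ⊢
      linarith
    · rintro _ ⟨A, hA, rfl⟩
      have hA' : A.PosDef := hA
      -- In (ii) positivity of `K` is not assumed; it follows from `A > 0` and the contraction.
      have hKA := hH.posDef_smul_add_one hp hA' hK.posSemidef
      have ht := reTr_posDef_pos hn (posDef_matPow hKA (1 / (q - 1)))
      have h := reTr_matPow_mul_le hX hKA.posSemidef hp hp1 (hXt' ▸ hγ) ht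
      simp only
      rw [matExp_eq (hA'.1.add (isHermitian_mul_mul_conjTranspose H hB)),
        mul_qLog_inv_mul hγ ht.le]
      have hSA := hS A
      rw [hXt'] at h
      rw [← hq2] at hSA ⊢
      have := div_le_div_of_nonneg_right (sub_le_sub_right h γ) hp.le
      linarith
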